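/- A twofold triple system TTS$(v)$ consists of a set $V$ of $v$ points together with a finite collection $\mathcal{B}$ of 3-element subsets of $V$ (called triples, possibly repeated) such that every 2-element subset of $V$ is contained in exactly two triples of $\mathcal{B}$, counted with multiplicity. Its 2-block-intersection graph (2-BIG) is the graph with vertex set $\mathcal{B}$ in which two triples $B_1, B_2$ are adjacent if and only if $|B_1 \cap B_2| = 2$. **Theorem.** Let $v \geq 7$ be odd. If there exists a TTS$(v)$ whose 2-BIG is Hamiltonian (i.e. has a Hamilton cycle), then there exists a TTS$(3v+1)$ whose 2-BIG is Hamiltonian. -/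

import Mathlib

/-- The blocks `B i`, indexed by a finite type `ι` so that repeated blocks are allowed, form a
balanced incomplete block design BIBD(`v`, `k`, `lam`) on the point set `V`: there are `v` points,
every block has `k` points, and every 2-subset of `V` is contained in exactly `lam` blocks
(counted with multiplicity). -/
def IsBIBD {V ι : Type*} [Fintype V] [DecidableEq V] [Fintype ι]
    (B : ι → Finset V) (v k lam : ℕ) : Prop :=
  Fintype.card V = v ∧
  (∀ i, (B i).card = k) ∧
  (∀ e : Finset V, e.card = 2 → (Finset.univ.filter (fun i => e ⊆ B i)).card = lam)

/-- A twofold triple system TTS(`v`) is a BIBD(`v`, 3, 2). -/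
def IsTTS {V ι : Type*} [Fintype V] [DecidableEq V] [Fintype ι]
    (B : ι → Finset V) (v : ℕ) : Prop :=
  IsBIBD B v 3 2

/-- The `n`-block-intersection graph (`n`-BIG) of a family of blocks: its vertices are the blocks
(one vertex per index, so a repeated block gives several vertices), and two distinct vertices are
adjacent if and only if the blocks have exactly `n` points in common. -/
def blockIntersectionGraph {V ι : Type*} [DecidableEq V] (n : ℕ) (B : ι → Finset V) :
    SimpleGraph ι where
  Adj i j := i ≠ j ∧ (B i ∩ B j).card = n
  symm := ⟨fun _ _ h => ⟨h.1.symm, by rw [Finset.inter_comm]; exact h.2⟩⟩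
  loopless := ⟨fun _ h => h.1 rfl⟩

/-! The construction triples the given system and adds a point `none`. The Latin squares `alpha` and
`beta` have third entries `-x - y` and `1 - x - y`, so together they cover every pair on different
levels twice. Pairs inside a level are covered by a copy of the given system on that level. For each
`x`, `alpha x x` is replaced by three corner triples, which cover its pairs once and join `none`
twice to each of its points (`covers_corners`). Since `v` is odd, `x ↦ -2 * x` permutes `ZMod v`, so
every point lies on exactly one `alpha x x` (`sum_infCovers`).

Within row `x`, alternating `beta` and `alpha` gives a path whose corners stand in for `alpha x x`.
It ends at `beta x 0`, which meets the start of row `x - 1`, so the rows close up into one cycle.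
That cycle misses the copies on the three levels.

Each copy is spliced in by a Pasch switch. A triple `alpha x y` with `x ≠ y`, two corners through
`none` and one block `{a, b, c}` of the copy form a Pasch configuration: four triples on six points.
The opposite four triples cover the same twelve pairs. Two of them contain `{a, b}` and `{b, c}`, so
they attach to the ends of the copy's cycle opened at `{a, b, c}` (`exists_isPuncturedWalk`); all
four reconnect the broken rows. The switches use rows `5, 4, 3`, rows `2, 1` and rows `0, -1`: seven
rows, hence `v ≥ 7`. The lemmas `isWalkList_gadget…` give adjacency and `pairCount_gadget…` show
that pair counts are unchanged; `sum_all_covers` supplies the total 2. -/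

/-! ### Walks as vertex lists -/

/-- `l` is a walk from `a` to `b` for the relation `R`, given as the list of its vertices. -/
def IsWalkList {α : Type*} (R : α → α → Prop) (a b : α) (l : List α) : Prop :=
  l.IsChain R ∧ l.head? = some a ∧ l.getLast? = some b

namespace IsWalkList

variable {α β : Type*} {R : α → α → Prop} {a b c d : α} {l l' : List α}

theorem singleton (a : α) : IsWalkList R a a [a] := by
  simp [IsWalkList]

theorem append (h : IsWalkList R a b l) (hR : R b c) (h' : IsWalkList R c d l') :
    IsWalkList R a d (l ++ l') := by
  refine ⟨List.isChain_append.2 ⟨h.1, h'.1, ?_⟩, ?_, ?_⟩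
  · intro x hx y hy
    rw [h.2.2] at hx
    rw [h'.2.1] at hy
    cases hx
    cases hy
    exact hR
  · simp [h.2.1]
  · simp [h'.2.2]

theorem cons (hR : R a b) (h : IsWalkList R b c l) : IsWalkList R a c (a :: l) :=
  (singleton a).append hR h

theorem reverse (hs : ∀ x y, R x y → R y x) (h : IsWalkList R a b l) :
    IsWalkList R b a l.reverse := by
  refine ⟨List.isChain_reverse.2 (h.1.imp fun x y => hs x y), ?_, ?_⟩
  · simp [h.2.2]
  · simp [h.2.1]

theorem map {S : β → β → Prop} {f : α → β} (hf : ∀ x y, R x y → S (f x) (f y))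
    (h : IsWalkList R a b l) : IsWalkList S (f a) (f b) (l.map f) := by
  refine ⟨List.isChain_map_of_isChain f hf h.1, ?_, ?_⟩
  · simp [h.2.1]
  · simp [h.2.2]

end IsWalkList

/-! ### Adjacency of blocks and pair counting -/

/-- Two blocks meet in exactly two points. -/
def MeetsInTwo {V : Type*} [DecidableEq V] (B C : Finset V) : Prop := (B ∩ C).card = 2

theorem MeetsInTwo.symm {V : Type*} [DecidableEq V] {B C : Finset V} (h : MeetsInTwo B C) :
    MeetsInTwo C B := by
  rwa [MeetsInTwo, Finset.inter_comm]

/-- The number of blocks in the list `l` that contain both `p` and `q`. -/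
def pairCount {V : Type*} [DecidableEq V] (p q : V) (l : List (Finset V)) : ℕ :=
  l.countP (fun B => p ∈ B ∧ q ∈ B)

/-- The number of times a block covers the pair `p`, `q`. -/
def covers {V : Type*} [DecidableEq V] (p q : V) (B : Finset V) : ℕ :=
  if p ∈ B ∧ q ∈ B then 1 else 0

section pairCount

variable {V : Type*} [DecidableEq V] (p q : V)

@[simp] theorem pairCount_nil : pairCount p q [] = 0 := rfl

@[simp] theorem pairCount_cons (B : Finset V) (l : List (Finset V)) :
    pairCount p q (B :: l) = covers p q B + pairCount p q l := by
  by_cases h : p ∈ B ∧ q ∈ B <;> simp [pairCount, covers, h, add_comm]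

@[simp] theorem pairCount_append (l l' : List (Finset V)) :
    pairCount p q (l ++ l') = pairCount p q l + pairCount p q l' :=
  List.countP_append

@[simp] theorem pairCount_reverse (l : List (Finset V)) :
    pairCount p q l.reverse = pairCount p q l :=
  List.countP_reverse

end pairCount

/-! ### Hamilton cycles as cyclic lists of blocks -/

/-- A Hamiltonian twofold triple system gives a cyclic list of its blocks in which consecutive
blocks meet in two points. -/
theorem exists_block_list_of_isHamiltonian {V ι : Type*} [Fintype V] [DecidableEq V] [Fintype ι]
    [DecidableEq ι] {B : ι → Finset V} {v : ℕ} (hv : 4 ≤ v) (hB : IsTTS B v)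
    (hH : (blockIntersectionGraph 2 B).IsHamiltonian) :
    ∃ (B₀ B₁ B₂ : Finset V) (l : List (Finset V)), IsWalkList MeetsInTwo B₁ B₂ l ∧
      MeetsInTwo B₀ B₁ ∧ MeetsInTwo B₂ B₀ ∧ 2 ≤ l.length ∧
      (∀ C ∈ B₀ :: l, C.card = 3) ∧ ∀ p q, p ≠ q → pairCount p q (B₀ :: l) = 2 := by
  obtain ⟨hV, h3, h2⟩ := hB
  -- `IsHamiltonian` holds trivially for a one-vertex graph; here some pair lies in two blocks,
  -- which rules that case out.
  have hι : Fintype.card ι ≠ 1 := by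
    intro h1
    have : 1 < Fintype.card V := by omega
    obtain ⟨p, q, hpq⟩ := Fintype.one_lt_card_iff.1 this
    have := h2 {p, q} (Finset.card_pair hpq)
    have hle := Finset.card_le_univ (Finset.univ.filter (fun i => {p, q} ⊆ B i))
    omega
  obtain ⟨a, w, hw⟩ := hH hι
  have hlen := hw.isCycle.three_le_length
  cases w with
  | nil => simp at hlen
  | @cons _ b _ hab w =>
    have hham := (SimpleGraph.Walk.isHamiltonianCycle_iff_isCycle_and_support_count_tail_eq_one.1
      hw).2
    cases w with
    | nil => simp at hlen
    | @cons _ c _ hbc r =>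
      have hwalk : IsWalkList (blockIntersectionGraph 2 B).Adj c a r.support := by
        refine ⟨r.isChain_adj_support, ?_, ?_⟩
        · rw [List.head?_eq_some_head r.support_ne_nil, r.head_support]
        · rw [List.getLast?_eq_some_getLast r.support_ne_nil, r.getLast_support]
      -- The cycle is `a, b, c, …, a`: singling out `b` leaves the path from `c` round to `a`.
      refine ⟨B b, B c, B a, r.support.map B, hwalk.map fun x y h => h.2, hbc.2, hab.2, ?_, ?_, ?_⟩
      · simp at hlen ⊢
        omega
      · intro C hC
        simp only [List.mem_cons, List.mem_map] at hC
        rcases hC with rfl | ⟨i, -, rfl⟩ <;> exact h3 _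
      · intro p q hpq
        have hperm : (b :: r.support).Perm Finset.univ.toList := by
          rw [List.perm_iff_count]
          intro i
          have := hham i
          simp only [SimpleGraph.Walk.support_cons, List.tail_cons] at this
          rw [this, List.count_eq_one_of_mem (Finset.nodup_toList _) (by simp)]
        have h := h2 {p, q} (Finset.card_pair hpq)
        have e : pairCount p q ((b :: r.support).map B) = 2 := by
          rw [pairCount, List.countP_map, hperm.countP_eq, ← h, Finset.card_def,
            Finset.filter_val, ← Multiset.countP_eq_card_filter, ← Finset.coe_toList,
            Multiset.coe_countP]
          simp [Finset.insert_subset_iff, Function.comp_def]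
        simpa using e

/-- A cyclic list of triples covering each pair twice, in which consecutive triples meet in two
points, is a Hamiltonian twofold triple system. -/
theorem exists_isTTS_isHamiltonian_of_list {V : Type} [Fintype V] [DecidableEq V] {v : ℕ}
    (hV : Fintype.card V = v) {B₁ B₂ : Finset V} {l : List (Finset V)}
    (hl : IsWalkList MeetsInTwo B₁ B₂ l) (hcyc : MeetsInTwo B₂ B₁) (hlen : 3 ≤ l.length)
    (h3 : ∀ C ∈ l, C.card = 3) (h2 : ∀ p q, p ≠ q → pairCount p q l = 2) :
    ∃ (V ι : Type) (_ : Fintype V) (_ : DecidableEq V) (_ : Fintype ι) (_ : DecidableEq ι)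
      (B : ι → Finset V), IsTTS B v ∧ (blockIntersectionGraph 2 B).IsHamiltonian := by
  -- Indexing by positions keeps repeated triples as separate vertices.
  refine ⟨V, Fin l.length, inferInstance, inferInstance, inferInstance, inferInstance, l.get,
    ⟨hV, fun i => h3 _ (l.get_mem i), fun e he => ?_⟩, fun _ => ?_⟩
  · obtain ⟨p, q, hpq, rfl⟩ := Finset.card_eq_two.1 he
    have hmap : (Finset.univ.val.map l.get : Multiset (Finset V)) = l := by
      rw [Fin.univ_val_map, List.ofFn_get]
    rw [← h2 p q hpq, pairCount, ← Multiset.coe_countP, ← hmap, Multiset.countP_map,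
      Finset.card_def, Finset.filter_val]
    simp [Finset.insert_subset_iff]
  · set G := blockIntersectionGraph 2 l.get
    have hchain : (List.finRange l.length).IsChain G.Adj := by
      rw [List.isChain_iff_getElem]
      intro i hi
      simp only [List.getElem_finRange]
      refine ⟨by simp [Fin.ext_iff], ?_⟩
      simp at hi
      exact List.isChain_iff_getElem.1 hl.1 i hi
    have hne : List.finRange l.length ≠ [] := by
      rw [← List.length_pos_iff, List.length_finRange]
      omega
    have hfirst : l[0] = B₁ := by
      have := hl.2.1
      rw [List.head?_eq_getElem?] at this
      simpa using (List.getElem?_eq_some_iff.1 this).2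
    have hlast : l[l.length - 1] = B₂ := by
      have := hl.2.2
      rw [List.getLast?_eq_getElem?] at this
      simpa using (List.getElem?_eq_some_iff.1 this).2
    have hadj : G.Adj ((List.finRange l.length).getLast hne)
        ((List.finRange l.length).head hne) := by
      rw [List.getLast_eq_getElem, List.head_eq_getElem]
      simp only [List.getElem_finRange, List.length_finRange]
      refine ⟨by simp [Fin.ext_iff]; omega, ?_⟩
      change (l[l.length - 1] ∩ l[0]).card = 2
      rw [hfirst, hlast]
      exact hcyc
    refine ⟨_, .cons hadj (.ofSupport _ hne hchain), ?_⟩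
    rw [SimpleGraph.Walk.isHamiltonianCycle_iff_isCycle_and_length_eq,
      SimpleGraph.Walk.isCycle_iff_isPath_tail_and_le_length]
    simp only [SimpleGraph.Walk.length_cons, SimpleGraph.Walk.length_ofSupport,
      List.length_finRange, Fintype.card_fin]
    refine ⟨⟨?_, by omega⟩, by omega⟩
    apply SimpleGraph.Walk.IsPath.mk'
    simpa using List.nodup_finRange _

/-! ### Opening the given cycle at a prescribed block -/

theorem exists_equiv_apply_eq_three {V X : Type*} [Fintype V] [Fintype X] [DecidableEq X]
    (h : Fintype.card V = Fintype.card X) {x y z : V} {a b c : X} (hxy : x ≠ y) (hxz : x ≠ z)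
    (hyz : y ≠ z) (hab : a ≠ b) (hac : a ≠ c) (hbc : b ≠ c) :
    ∃ σ : V ≃ X, σ x = a ∧ σ y = b ∧ σ z = c := by
  obtain ⟨e⟩ := Fintype.card_eq.1 h
  let e₁ := e.trans (Equiv.swap (e x) a)
  have h₁ : e₁ x = a := by simp [e₁]
  let e₂ := e₁.trans (Equiv.swap (e₁ y) b)
  have h₂ : e₂ y = b := by simp [e₂]
  have h₂' : e₂ x = a := by
    have : a ≠ e₁ y := fun h => hxy (e₁.injective (h₁.trans h))
    simp [e₂, h₁, Equiv.swap_apply_of_ne_of_ne this hab]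
  let e₃ := e₂.trans (Equiv.swap (e₂ z) c)
  refine ⟨e₃, ?_, ?_, by simp [e₃]⟩
  · have : a ≠ e₂ z := fun h => hxz (e₂.injective (h₂'.trans h))
    simp [e₃, h₂', Equiv.swap_apply_of_ne_of_ne this hac]
  · have : b ≠ e₂ z := fun h => hyz (e₂.injective (h₂.trans h))
    simp [e₃, h₂, Equiv.swap_apply_of_ne_of_ne this hbc]

theorem meetsInTwo_of_mem {V : Type*} [DecidableEq V] {B C : Finset V} (hB : B.card = 3)
    {p q r : V} (hpq : p ≠ q) (hpB : p ∈ B) (hqB : q ∈ B) (hpC : p ∈ C) (hqC : q ∈ C)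
    (hrB : r ∈ B) (hrC : r ∉ C) : MeetsInTwo B C := by
  have h₁ : 2 ≤ (B ∩ C).card := by
    rw [← Finset.card_pair hpq]
    apply Finset.card_le_card
    simp [Finset.insert_subset_iff, *]
  have h₂ : (B ∩ C).card < B.card := by
    apply Finset.card_lt_card
    refine Finset.ssubset_iff_subset_ne.2 ⟨Finset.inter_subset_left, fun h => hrC ?_⟩
    rw [← h] at hrB
    exact (Finset.mem_inter.1 hrB).2
  unfold MeetsInTwo
  omega

theorem pairCount_map {V W : Type*} [DecidableEq V] [DecidableEq W] (f : V ↪ W) (p q : V)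
    (l : List (Finset V)) :
    pairCount (f p) (f q) (l.map (Finset.map f)) = pairCount p q l := by
  simp [pairCount, List.countP_map, Function.comp_def]

theorem MeetsInTwo.map {V W : Type*} [DecidableEq V] [DecidableEq W] (f : V ↪ W)
    {B C : Finset V} (h : MeetsInTwo B C) : MeetsInTwo (B.map f) (C.map f) := by
  rwa [MeetsInTwo, ← Finset.map_inter, Finset.card_map]

/-- A walk through all the blocks but `{a, b, c}` of a twofold triple system on `X`, such that
the omitted block is joined to the first block along `{a, b}` and to the last one along
`{b, c}`. -/
structure IsPuncturedWalk {X : Type*} [DecidableEq X] (a b c : X) (F E : Finset X)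
    (l : List (Finset X)) : Prop where
  walk : IsWalkList MeetsInTwo F E l
  left_mem_first : a ∈ F
  middle_mem_first : b ∈ F
  middle_mem_last : b ∈ E
  right_mem_last : c ∈ E
  card_eq : ∀ C ∈ l, C.card = 3
  pairCount_eq : ∀ p q, p ≠ q → pairCount p q l + covers p q {a, b, c} = 2

/-- The neighbours of `B₀` in the cycle meet it in different pairs, and two different pairs in a
triple share exactly one point. That point becomes `b`, and a relabelling carries `B₀` to any chosen
triple. -/
theorem exists_isPuncturedWalk {V X : Type*} [Fintype V] [DecidableEq V] [Fintype X]
    [DecidableEq X] (hX : Fintype.card V = Fintype.card X) {B₀ B₁ B₂ : Finset V}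
    {l : List (Finset V)} (hl : IsWalkList MeetsInTwo B₁ B₂ l) (h₁ : MeetsInTwo B₀ B₁)
    (h₂ : MeetsInTwo B₂ B₀) (hlen : 2 ≤ l.length) (h3 : ∀ C ∈ B₀ :: l, C.card = 3)
    (hcount : ∀ p q, p ≠ q → pairCount p q (B₀ :: l) = 2)
    {a b c : X} (hab : a ≠ b) (hac : a ≠ c) (hbc : b ≠ c) :
    ∃ F E l', IsPuncturedWalk a b c F E l' := by
  -- Displays `B₁` and `B₂` as separate entries of the list, so that both are counted below even if
  -- they are equal as sets.
  obtain ⟨m, rfl⟩ : ∃ m, l = B₁ :: m ++ [B₂] := by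
    obtain ⟨-, hh, ht⟩ := hl
    cases l with
    | nil => simp at hh
    | cons C l =>
      obtain rfl : C = B₁ := by simpa using hh
      have hl0 : l ≠ [] := by
        rintro rfl
        simp at hlen
      refine ⟨l.dropLast, ?_⟩
      rw [List.getLast?_cons, Option.some_inj] at ht
      rw [List.getLast?_eq_some_getLast hl0, Option.getD_some] at ht
      rw [← ht, List.cons_append, List.dropLast_append_getLast]
  have hB₀ : B₀.card = 3 := h3 _ (by simp)
  -- Otherwise the common pair would be covered by all of `B₀`, `B₁`, `B₂`, three times.
  have hne : B₀ ∩ B₁ ≠ B₂ ∩ B₀ := by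
    intro h
    obtain ⟨p, q, hpq, hS⟩ := Finset.card_eq_two.1 h₁
    have h1 : p ∈ B₀ ∩ B₁ := by simp [hS]
    have h2 : q ∈ B₀ ∩ B₁ := by simp [hS]
    have h1' := h ▸ h1
    have h2' := h ▸ h2
    rw [Finset.mem_inter] at h1 h2 h1' h2'
    have := hcount p q hpq
    simp [covers, h1, h2, h1', h2'] at this
    omega
  obtain ⟨x, hxS, hxT⟩ : ∃ x ∈ B₀ ∩ B₁, x ∉ B₂ ∩ B₀ := by
    by_contra! h
    exact hne (Finset.eq_of_subset_of_card_le h (by rw [h₁, h₂]))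
  obtain ⟨z, hzT, hzS⟩ : ∃ z ∈ B₂ ∩ B₀, z ∉ B₀ ∩ B₁ := by
    by_contra! h
    exact hne (Finset.eq_of_subset_of_card_le h (by rw [h₁, h₂])).symm
  obtain ⟨y, hy⟩ : ((B₀ ∩ B₁) ∩ (B₂ ∩ B₀)).Nonempty := by
    rw [← Finset.card_pos]
    have h := Finset.card_union_add_card_inter (B₀ ∩ B₁) (B₂ ∩ B₀)
    have h' : ((B₀ ∩ B₁) ∪ (B₂ ∩ B₀)).card ≤ B₀.card :=
      Finset.card_le_card (Finset.union_subset Finset.inter_subset_left Finset.inter_subset_right)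
    have h₁' : (B₀ ∩ B₁).card = 2 := h₁
    have h₂' : (B₂ ∩ B₀).card = 2 := h₂
    omega
  obtain ⟨hyS, hyT⟩ := Finset.mem_inter.1 hy
  have hxy : x ≠ y := fun h => hxT (h ▸ hyT)
  have hyz : y ≠ z := fun h => hzS (h ▸ hyS)
  have hxz : x ≠ z := fun h => hzS (h ▸ hxS)
  rw [Finset.mem_inter] at hxS hyS hyT hzT
  have hB : B₀ = {x, y, z} := by
    symm
    apply Finset.eq_of_subset_of_card_le
    · simp [Finset.insert_subset_iff, hxS, hyS, hzT]
    · rw [hB₀, Finset.card_eq_three.2 ⟨x, y, z, hxy, hxz, hyz, rfl⟩]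
  obtain ⟨σ, rfl, rfl, rfl⟩ := exists_equiv_apply_eq_three hX hxy hxz hyz hab hac hbc
  refine ⟨_, _, _, hl.map fun _ _ h => h.map σ.toEmbedding, ?_, ?_, ?_, ?_, ?_, ?_⟩
  · simp [hxS]
  · simp [hyS]
  · simp [hyT]
  · simp [hzT]
  · intro C hC
    obtain ⟨D, hD, rfl⟩ := List.mem_map.1 hC
    rw [Finset.card_map]
    exact h3 _ (by simp at hD ⊢; tauto)
  · intro p q hpq
    obtain ⟨p, rfl⟩ := σ.surjective p
    obtain ⟨q, rfl⟩ := σ.surjective q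
    have h := hcount p q (fun h => hpq (by rw [h]))
    rw [← pairCount_map σ.toEmbedding] at h
    simp only [List.map_cons, pairCount_cons, hB] at h
    rw [add_comm, ← h]
    congr 1
    simp [covers]

/-! ### The triples of the tripling construction -/

/-- Three copies of `ZMod v`, indexed by `Fin 3`, together with a point at infinity. -/
abbrev Point (v : ℕ) : Type := Option (Fin 3 × ZMod v)

namespace Point

variable {v : ℕ}

/-- The copy of `x` on level `i`. -/
def pt (i : Fin 3) (x : ZMod v) : Point v := some (i, x)

@[simp] theorem pt_inj {i j : Fin 3} {x y : ZMod v} : pt i x = pt j y ↔ i = j ∧ x = y := by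
  simp [pt]

@[simp] theorem pt_ne_none (i : Fin 3) (x : ZMod v) : pt i x ≠ none := by simp [pt]

@[simp] theorem none_ne_pt (i : Fin 3) (x : ZMod v) : (none : Point v) ≠ pt i x := by simp [pt]

/-- The triples of the first Latin square. -/
def alpha (x y : ZMod v) : Finset (Point v) := {pt 0 x, pt 1 y, pt 2 (-x - y)}

/-- The triples of the second Latin square. -/
def beta (x y : ZMod v) : Finset (Point v) := {pt 0 x, pt 1 y, pt 2 (1 - x - y)}

/-- A triple through the point at infinity. -/
def inf (p q : Point v) : Finset (Point v) := {none, p, q}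

/-- The triples through infinity and two points of `alpha x x`. -/
def corner01 (x : ZMod v) : Finset (Point v) := inf (pt 0 x) (pt 1 x)

/-- See `corner01`. -/
def corner12 (x : ZMod v) : Finset (Point v) := inf (pt 1 x) (pt 2 (-2 * x))

/-- See `corner01`. -/
def corner02 (x : ZMod v) : Finset (Point v) := inf (pt 0 x) (pt 2 (-2 * x))

theorem card_triple {V : Type*} [DecidableEq V] {a b c : V} (hab : a ≠ b) (hac : a ≠ c)
    (hbc : b ≠ c) : ({a, b, c} : Finset V).card = 3 :=
  Finset.card_eq_three.2 ⟨a, b, c, hab, hac, hbc, rfl⟩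

@[simp] theorem card_alpha (x y : ZMod v) : (alpha x y).card = 3 :=
  card_triple (by simp) (by simp) (by simp)

@[simp] theorem card_beta (x y : ZMod v) : (beta x y).card = 3 :=
  card_triple (by simp) (by simp) (by simp)

theorem card_inf {i j : Fin 3} {x y : ZMod v} (h : i ≠ j ∨ x ≠ y) :
    (inf (pt i x) (pt j y)).card = 3 :=
  card_triple (by simp) (by simp) (by simp; tauto)

@[simp] theorem card_corner01 (x : ZMod v) : (corner01 x).card = 3 := card_inf (by simp)

@[simp] theorem card_corner12 (x : ZMod v) : (corner12 x).card = 3 := card_inf (by simp)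

@[simp] theorem card_corner02 (x : ZMod v) : (corner02 x).card = 3 := card_inf (by simp)

section meets

variable (x y : ZMod v)

/-- The squares differ by 1 in the third entry. Keeping two of the three coordinates of a `beta`
triple therefore gives three `alpha` neighbours: this one, the previous column of the same row, and
the same column of row `x - 1`. -/
theorem beta_meets_alpha [Fact (1 < v)] : MeetsInTwo (beta x y) (alpha x y) :=
  meetsInTwo_of_mem (p := pt 0 x) (q := pt 1 y) (r := pt 2 (1 - x - y)) (by simp) (by simp)
    (by simp [beta]) (by simp [beta]) (by simp [alpha]) (by simp [alpha]) (by simp [beta])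
    (by simp [alpha])

theorem alpha_meets_beta [Fact (1 < v)] {z : ZMod v} (h : y + 1 = z) :
    MeetsInTwo (alpha x y) (beta x z) :=
  meetsInTwo_of_mem (p := pt 0 x) (q := pt 2 (-x - y)) (r := pt 1 y) (by simp) (by simp)
    (by simp [alpha]) (by simp [alpha]) (by simp [beta]) (by simp [beta, ← h]; ring)
    (by simp [alpha]) (by simp [beta, ← h])

theorem beta_meets_alpha_sub_one [Fact (1 < v)] {z : ZMod v} (h : z + 1 = x) :
    MeetsInTwo (beta x y) (alpha z y) :=
  meetsInTwo_of_mem (p := pt 1 y) (q := pt 2 (1 - x - y)) (r := pt 0 x) (by simp) (by simp)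
    (by simp [beta]) (by simp [beta]) (by simp [alpha]) (by simp [alpha, ← h])
    (by simp [beta]) (by simp [alpha, ← h])

theorem beta_meets_corner01 : MeetsInTwo (beta x x) (corner01 x) :=
  meetsInTwo_of_mem (p := pt 0 x) (q := pt 1 x) (r := pt 2 (1 - x - x)) (by simp) (by simp)
    (by simp [beta]) (by simp [beta]) (by simp [corner01, inf]) (by simp [corner01, inf])
    (by simp [beta]) (by simp [corner01, inf])

theorem corner01_meets_corner12 : MeetsInTwo (corner01 x) (corner12 x) :=
  meetsInTwo_of_mem (p := none) (q := pt 1 x) (r := pt 0 x) (by simp)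
    (by simp) (by simp [corner01, inf]) (by simp [corner01, inf]) (by simp [corner12, inf])
    (by simp [corner12, inf]) (by simp [corner01, inf]) (by simp [corner12, inf])

theorem corner12_meets_corner02 : MeetsInTwo (corner12 x) (corner02 x) :=
  meetsInTwo_of_mem (p := none) (q := pt 2 (-2 * x)) (r := pt 1 x) (by simp)
    (by simp) (by simp [corner12, inf]) (by simp [corner12, inf]) (by simp [corner02, inf])
    (by simp [corner02, inf]) (by simp [corner12, inf]) (by simp [corner02, inf])

theorem corner02_meets_corner01 : MeetsInTwo (corner02 x) (corner01 x) :=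
  meetsInTwo_of_mem (p := none) (q := pt 0 x) (r := pt 2 (-2 * x)) (by simp)
    (by simp) (by simp [corner02, inf]) (by simp [corner02, inf]) (by simp [corner01, inf])
    (by simp [corner01, inf]) (by simp [corner02, inf]) (by simp [corner01, inf])

theorem corner02_meets_beta {z : ZMod v} (h : x + 1 = z) :
    MeetsInTwo (corner02 x) (beta x z) :=
  meetsInTwo_of_mem (p := pt 0 x) (q := pt 2 (-2 * x)) (r := none) (by simp) (by simp)
    (by simp [corner02, inf]) (by simp [corner02, inf]) (by simp [beta])
    (by simp [beta, ← h]; ring) (by simp [corner02, inf]) (by simp [beta])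

theorem corner12_meets_beta {z : ZMod v} (h : x + 1 = z) :
    MeetsInTwo (corner12 x) (beta z x) :=
  meetsInTwo_of_mem (p := pt 1 x) (q := pt 2 (-2 * x)) (r := none) (by simp) (by simp)
    (by simp [corner12, inf]) (by simp [corner12, inf]) (by simp [beta])
    (by simp [beta, ← h]; ring) (by simp [corner12, inf]) (by simp [beta])

end meets

/-! ### Rows of the cycle -/

/-- The walk `beta x y, alpha x y, beta x (y + 1), …` with `2 * n` vertices. -/
def run (x y : ZMod v) : ℕ → List (Finset (Point v))
  | 0 => []
  | n + 1 => beta x y :: alpha x y :: run x (y + 1) n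

theorem run_add (x y : ZMod v) (m n : ℕ) :
    run x y (m + n) = run x y m ++ run x (y + m) n := by
  induction m generalizing y with
  | zero => simp [run]
  | succ m ih =>
    rw [Nat.add_right_comm, run, ih, run]
    simp [add_comm, add_left_comm]

theorem isWalkList_run [Fact (1 < v)] (x : ZMod v) (n : ℕ) {y z : ZMod v} (h : y + n = z) :
    IsWalkList MeetsInTwo (beta x y) (alpha x z) (run x y (n + 1)) := by
  induction n generalizing y with
  | zero =>
    obtain rfl : y = z := by simpa using h
    exact .cons (beta_meets_alpha x y) (.singleton _)
  | succ n ih =>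
    refine .cons (beta_meets_alpha x y) (.cons (alpha_meets_beta x y rfl) (ih ?_))
    rw [← h]
    push_cast
    ring

theorem card_of_mem_run {x y : ZMod v} {n : ℕ} {C : Finset (Point v)} (h : C ∈ run x y n) :
    C.card = 3 := by
  induction n generalizing y with
  | zero => simp [run] at h
  | succ n ih =>
    simp only [run, List.mem_cons] at h
    rcases h with rfl | rfl | h
    · simp
    · simp
    · exact ih h

/-- The embedding of a level. -/
def level (i : Fin 3) : ZMod v ↪ Point v := ⟨pt i, fun x y h => by simpa using h⟩

@[simp] theorem level_apply (i : Fin 3) (x : ZMod v) : level i x = pt i x := rfl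

@[simp] theorem pt_mem_map_level {i j : Fin 3} {x : ZMod v} {S : Finset (ZMod v)} :
    pt i x ∈ S.map (level j) ↔ i = j ∧ x ∈ S := by
  simp only [Finset.mem_map, level_apply, pt_inj]
  constructor
  · rintro ⟨y, hy, rfl, rfl⟩
    exact ⟨rfl, hy⟩
  · rintro ⟨rfl, hx⟩
    exact ⟨x, hx, rfl, rfl⟩

@[simp] theorem none_notMem_map_level {j : Fin 3} {S : Finset (ZMod v)} :
    none ∉ S.map (level j) := by
  simp

theorem _root_.IsWalkList.map_level {F E : Finset (ZMod v)} {l : List (Finset (ZMod v))}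
    (h : IsWalkList MeetsInTwo F E l) (i : Fin 3) :
    IsWalkList MeetsInTwo (F.map (level i)) (E.map (level i))
      (l.map (Finset.map (level i))) :=
  h.map fun _ _ h => h.map _

/-- A row of the cycle that is not affected by the trades. -/
def row (x : ZMod v) (m n : ℕ) : List (Finset (Point v)) :=
  alpha x 0 :: (run x 1 (m + 1) ++ (beta x x :: corner01 x :: corner12 x :: corner02 x ::
    (run x (x + 1) (n + 1) ++ [beta x 0])))

/-- The hypotheses place the last column of the first run at `x - 1` and that of the second at `-1`.
-/
theorem isWalkList_row [Fact (1 < v)] {x : ZMod v} {m n : ℕ} (hm : (m : ZMod v) + 2 = x)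
    (hn : x + n + 2 = 0) : IsWalkList MeetsInTwo (alpha x 0) (beta x 0) (row x m n) := by
  refine .cons (alpha_meets_beta _ _ (zero_add 1)) ((isWalkList_run x m rfl).append
    (alpha_meets_beta _ _ ?_) (.cons (beta_meets_corner01 x) (.cons (corner01_meets_corner12 x)
    (.cons (corner12_meets_corner02 x) (.cons (corner02_meets_beta x rfl)
    ((isWalkList_run x n rfl).append (alpha_meets_beta _ _ ?_) (.singleton _)))))))
  · linear_combination hm
  · linear_combination hn

end Point

namespace Point

variable {v : ℕ}

theorem forall_mem_run_card_iff (x y : ZMod v) (n : ℕ) :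
    (∀ C ∈ run x y n, C.card = 3) ↔ True :=
  iff_true_intro fun _ => card_of_mem_run

/-! ### Splicing in the three levels -/

section zero

variable (w : ℕ) (l : List (Finset (ZMod v)))

/-- The part of the cycle in rows `5`, `4`, `3`, after the trade that joins the walk `l` through
level `0` to it. -/
def gadgetZero : List (Finset (Point v)) :=
  alpha 5 0 :: (run 5 1 2 ++ beta 5 3 :: {pt 0 5, pt 1 3, pt 0 3} ::
    ((run 4 5 (w + 2) ++ beta 4 0 :: alpha 3 0 :: (run 3 1 2 ++ [beta 3 3])).reverse ++
    {pt 0 5, pt 0 4, pt 2 (-8)} :: (l.map (Finset.map (level 0)) ++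
    inf (pt 0 4) (pt 0 3) :: corner01 4 ::
    ((run 5 4 1 ++ beta 5 5 :: corner01 5 :: corner12 5 :: corner02 5 :: (run 5 6 (w + 1) ++
      beta 5 0 :: alpha 4 0 :: (run 4 1 3 ++ [beta 4 4]))).reverse ++
    corner12 4 :: inf (pt 1 3) (pt 2 (-8)) :: corner12 3 :: corner02 3 ::
    (run 3 4 (w + 3) ++ [beta 3 0])))))

/-- Removing `alpha 5 3`, `corner02 4` and `corner01 3` cuts rows `5, 4, 3` into four pieces. The
new triples rejoin them with the stretch from `beta 4 5` to `beta 3 3` and that from `beta 5 4` to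
`beta 4 4` traversed backwards, and with `l` in between. -/
theorem isWalkList_gadgetZero [Fact (1 < v)] (hw : (w : ZMod v) + 7 = 0)
    (h2 : (2 : ZMod v) ≠ 0) {F E : Finset (ZMod v)} (hl : IsPuncturedWalk 5 4 3 F E l) :
    IsWalkList MeetsInTwo (alpha (5 : ZMod v) 0) (beta 3 0) (gadgetZero w l) := by
  have h1 : (1 : ZMod v) ≠ 0 := one_ne_zero
  have h54 : (5 : ZMod v) ≠ 4 := fun h => h1 (by linear_combination h)
  have h43 : (4 : ZMod v) ≠ 3 := fun h => h1 (by linear_combination h)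
  have h53 : (5 : ZMod v) ≠ 3 := fun h => h2 (by linear_combination h)
  have hs : ∀ x y : Finset (Point v), MeetsInTwo x y → MeetsInTwo y x := fun _ _ h => h.symm
  have e₁ : MeetsInTwo (beta (5 : ZMod v) 3) {pt 0 5, pt 1 3, pt 0 3} :=
    meetsInTwo_of_mem (p := pt 0 5) (q := pt 1 3) (r := pt 2 (1 - 5 - 3)) (card_beta _ _)
      (by simp) (by simp [beta]) (by simp [beta]) (by simp) (by simp) (by simp [beta]) (by simp)
  have e₂ : MeetsInTwo (beta (3 : ZMod v) 3) {pt 0 5, pt 1 3, pt 0 3} :=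
    meetsInTwo_of_mem (p := pt 0 3) (q := pt 1 3) (r := pt 2 (1 - 3 - 3)) (card_beta _ _)
      (by simp) (by simp [beta]) (by simp [beta]) (by simp) (by simp) (by simp [beta]) (by simp)
  have e₃ : MeetsInTwo (beta (4 : ZMod v) 5) {pt 0 5, pt 0 4, pt 2 (-8)} :=
    meetsInTwo_of_mem (p := pt 0 4) (q := pt 2 (-8)) (r := pt 1 5) (card_beta _ _)
      (by simp) (by simp [beta]) (by simp [beta]; norm_num) (by simp) (by simp) (by simp [beta])
      (by simp)
  have e₄ : MeetsInTwo ({pt 0 5, pt 0 4, pt 2 (-8)} : Finset (Point v)) (F.map (level 0)) :=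
    meetsInTwo_of_mem (p := pt 0 5) (q := pt 0 4) (r := pt 2 (-8))
      (card_triple (by simp [h54]) (by simp) (by simp))
      (by simp [h54]) (by simp) (by simp) (by simp [-Finset.mem_map, hl.left_mem_first])
      (by simp [-Finset.mem_map, hl.middle_mem_first]) (by simp) (by simp [-Finset.mem_map])
  have e₅ : MeetsInTwo (inf (pt 0 4) (pt 0 3)) (E.map (level 0)) :=
    meetsInTwo_of_mem (p := pt 0 4) (q := pt 0 3) (r := none)
      (card_inf (by simp [h43])) (by simp [h43]) (by simp [inf]) (by simp [inf])
      (by simp [-Finset.mem_map, hl.middle_mem_last])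
      (by simp [-Finset.mem_map, hl.right_mem_last]) (by simp [inf]) (by simp)
  have e₆ : MeetsInTwo (corner01 (4 : ZMod v)) (inf (pt 0 4) (pt 0 3)) :=
    meetsInTwo_of_mem (p := none) (q := pt 0 4) (r := pt 1 4) (by simp) (by simp)
      (by simp [corner01, inf]) (by simp [corner01, inf]) (by simp [inf]) (by simp [inf])
      (by simp [corner01, inf]) (by simp [inf])
  have e₇ : MeetsInTwo (corner12 (4 : ZMod v)) (inf (pt 1 3) (pt 2 (-8))) :=
    meetsInTwo_of_mem (p := none) (q := pt 2 (-8)) (r := pt 1 4) (by simp) (by simp)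
      (by simp [corner12, inf]) (by simp [corner12, inf]; norm_num) (by simp [inf])
      (by simp [inf]) (by simp [corner12, inf]) (by simp [inf, h43])
  have e₈ : MeetsInTwo (inf (pt 1 3) (pt 2 (-8))) (corner12 (3 : ZMod v)) :=
    meetsInTwo_of_mem (p := none) (q := pt 1 3) (r := pt 2 (-8)) (card_inf (by simp)) (by simp)
      (by simp [inf]) (by simp [inf]) (by simp [corner12, inf])
      (by simp [corner12, inf]) (by simp [inf]) (by
        simp [corner12, inf]
        exact fun h => h2 (by linear_combination h))
  have b₁ : IsWalkList MeetsInTwo (beta (4 : ZMod v) 5) (beta 3 3)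
      (run 4 5 (w + 2) ++ beta 4 0 :: alpha 3 0 :: (run 3 1 2 ++ [beta 3 3])) :=
    (isWalkList_run 4 (w + 1) rfl).append
      (alpha_meets_beta _ _ (by push_cast; linear_combination hw))
      (.cons (beta_meets_alpha_sub_one _ _ (by norm_num))
      (.cons (alpha_meets_beta _ _ (by norm_num)) ((isWalkList_run 3 1 rfl).append
      (alpha_meets_beta _ _ (by norm_num)) (.singleton _))))
  have b₂ : IsWalkList MeetsInTwo (beta (5 : ZMod v) 4) (beta 4 4)
      (run 5 4 1 ++ beta 5 5 :: corner01 5 :: corner12 5 :: corner02 5 :: (run 5 6 (w + 1) ++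
      beta 5 0 :: alpha 4 0 :: (run 4 1 3 ++ [beta 4 4]))) :=
    (isWalkList_run 5 0 rfl).append (alpha_meets_beta _ _ (by norm_num))
      (.cons (beta_meets_corner01 _) (.cons (corner01_meets_corner12 _)
      (.cons (corner12_meets_corner02 _) (.cons (corner02_meets_beta _ (by norm_num))
      ((isWalkList_run 5 w rfl).append
      (alpha_meets_beta _ _ (by linear_combination hw))
      (.cons (beta_meets_alpha_sub_one _ _ (by norm_num))
      (.cons (alpha_meets_beta _ _ (by norm_num)) ((isWalkList_run 4 2 rfl).append
      (alpha_meets_beta _ _ (by norm_num)) (.singleton _)))))))))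
  exact .cons (alpha_meets_beta _ _ (by norm_num)) ((isWalkList_run 5 1 rfl).append
    (alpha_meets_beta _ _ (by norm_num)) (.cons e₁ (.cons e₂.symm ((b₁.reverse hs).append e₃
    (.cons e₄ ((hl.walk.map_level 0).append e₅.symm (.cons e₆.symm (.cons
    (beta_meets_corner01 _).symm ((b₂.reverse hs).append
    (corner12_meets_beta _ (by norm_num)).symm (.cons e₇ (.cons e₈ (.cons
    (corner12_meets_corner02 _) (.cons (corner02_meets_beta _ (by norm_num))
    ((isWalkList_run 3 (w + 2) rfl).append
    (alpha_meets_beta _ _ (by push_cast; linear_combination hw)) (.singleton _)))))))))))))))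

theorem card_of_mem_gadgetZero [Fact (1 < v)] (h2 : (2 : ZMod v) ≠ 0) {F E : Finset (ZMod v)}
    (hl : IsPuncturedWalk 5 4 3 F E l) : ∀ C ∈ gadgetZero w l, C.card = 3 := by
  have h1 : (1 : ZMod v) ≠ 0 := one_ne_zero
  have h54 : (5 : ZMod v) ≠ 4 := fun h => h1 (by linear_combination h)
  have h43 : (4 : ZMod v) ≠ 3 := fun h => h1 (by linear_combination h)
  have h53 : (5 : ZMod v) ≠ 3 := fun h => h2 (by linear_combination h)
  have c₁ : ({pt 0 5, pt 1 3, pt 0 3} : Finset (Point v)).card = 3 :=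
    card_triple (by simp) (by simp [h53]) (by simp)
  have c₂ : ({pt 0 5, pt 0 4, pt 2 (-8)} : Finset (Point v)).card = 3 :=
    card_triple (by simp [h54]) (by simp) (by simp)
  have c₃ : (inf (pt 0 4) (pt 0 3) : Finset (Point v)).card = 3 := card_inf (by simp [h43])
  have c₄ : (inf (pt 1 3) (pt 2 (-8)) : Finset (Point v)).card = 3 := card_inf (by simp)
  simp only [gadgetZero, List.forall_mem_cons, List.forall_mem_append, List.mem_reverse,
    List.forall_mem_map, Finset.card_map, card_alpha, card_beta, card_corner01, card_corner12,
    card_corner02, c₁, c₂, c₃, c₄, List.not_mem_nil, IsEmpty.forall_iff, implies_true, and_true,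
    true_and, forall_mem_run_card_iff]
  exact hl.card_eq

end zero

section two

variable (w : ℕ) (l : List (Finset (ZMod v)))

/-- The part of the cycle in rows `2`, `1`, after the trade that joins the walk `l` through
level `2` to it. -/
def gadgetTwo : List (Finset (Point v)) :=
  alpha 2 0 :: (run 2 1 1 ++ beta 2 2 :: {pt 2 (-3), pt 2 (-4), pt 1 2} ::
    (l.map (Finset.map (level 2)) ++ inf (pt 2 (-4)) (pt 2 (-2)) :: corner12 1 :: corner01 1 ::
    ((run 2 3 (w + 4) ++ [beta 2 0, alpha 1 0, beta 1 1]).reverse ++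
    corner02 2 :: corner01 2 :: inf (pt 0 1) (pt 1 2) :: beta 1 2 ::
    {pt 2 (-3), pt 0 1, pt 2 (-2)} :: (run 1 3 (w + 4) ++ [beta 1 0]))))

/-- Here the removed triples are `corner12 2`, `corner02 1` and `alpha 1 2`; only the stretch from
`beta 2 3` to `beta 1 1` is reversed. -/
theorem isWalkList_gadgetTwo [Fact (1 < v)] (hw : (w : ZMod v) + 7 = 0)
    (h2 : (2 : ZMod v) ≠ 0) {F E : Finset (ZMod v)}
    (hl : IsPuncturedWalk (-3) (-4) (-2) F E l) :
    IsWalkList MeetsInTwo (alpha (2 : ZMod v) 0) (beta 1 0) (gadgetTwo w l) := by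
  have h1 : (1 : ZMod v) ≠ 0 := one_ne_zero
  have h34 : (-3 : ZMod v) ≠ -4 := fun h => h1 (by linear_combination h)
  have h42 : (-4 : ZMod v) ≠ -2 := fun h => h2 (by linear_combination -h)
  have h12 : (1 : ZMod v) ≠ 2 := fun h => h1 (by linear_combination -h)
  have hs : ∀ x y : Finset (Point v), MeetsInTwo x y → MeetsInTwo y x := fun _ _ h => h.symm
  have e₁ : MeetsInTwo (beta (2 : ZMod v) 2) {pt 2 (-3), pt 2 (-4), pt 1 2} :=
    meetsInTwo_of_mem (p := pt 2 (-3)) (q := pt 1 2) (r := pt 0 2) (card_beta _ _)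
      (by simp) (by simp [beta]; norm_num) (by simp [beta]) (by simp) (by simp) (by simp [beta])
      (by simp)
  have e₂ : MeetsInTwo ({pt 2 (-3), pt 2 (-4), pt 1 2} : Finset (Point v))
      (F.map (level 2)) :=
    meetsInTwo_of_mem (p := pt 2 (-3)) (q := pt 2 (-4)) (r := pt 1 2)
      (card_triple (by simpa using h34) (by simp) (by simp))
      (by simpa using h34) (by simp) (by simp) (by simp [-Finset.mem_map, hl.left_mem_first])
      (by simp [-Finset.mem_map, hl.middle_mem_first]) (by simp) (by simp [-Finset.mem_map])
  have e₃ : MeetsInTwo (inf (pt 2 (-4)) (pt 2 (-2))) (E.map (level 2)) :=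
    meetsInTwo_of_mem (p := pt 2 (-4)) (q := pt 2 (-2)) (r := none)
      (card_inf (Or.inr h42)) (by simpa using h42) (by simp [inf]) (by simp [inf])
      (by simp [-Finset.mem_map, hl.middle_mem_last])
      (by simp [-Finset.mem_map, hl.right_mem_last]) (by simp [inf]) (by simp)
  have e₄ : MeetsInTwo (corner12 (1 : ZMod v)) (inf (pt 2 (-4)) (pt 2 (-2))) :=
    meetsInTwo_of_mem (p := none) (q := pt 2 (-2)) (r := pt 1 1) (by simp) (by simp)
      (by simp [corner12, inf]) (by simp [corner12, inf]) (by simp [inf]) (by simp [inf])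
      (by simp [corner12, inf]) (by simp [inf])
  have e₅ : MeetsInTwo (corner01 (2 : ZMod v)) (inf (pt 0 1) (pt 1 2)) :=
    meetsInTwo_of_mem (p := none) (q := pt 1 2) (r := pt 0 2) (by simp) (by simp)
      (by simp [corner01, inf]) (by simp [corner01, inf]) (by simp [inf])
      (by simp [inf]) (by simp [corner01, inf]) (by simp [inf, h12.symm])
  have e₆ : MeetsInTwo (beta (1 : ZMod v) 2) (inf (pt 0 1) (pt 1 2)) :=
    meetsInTwo_of_mem (p := pt 0 1) (q := pt 1 2) (r := pt 2 (1 - 1 - 2)) (by simp) (by simp)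
      (by simp [beta]) (by simp [beta]) (by simp [inf]) (by simp [inf]) (by simp [beta])
      (by simp [inf])
  have e₇ : MeetsInTwo (beta (1 : ZMod v) 2) {pt 2 (-3), pt 0 1, pt 2 (-2)} :=
    meetsInTwo_of_mem (p := pt 0 1) (q := pt 2 (-2)) (r := pt 1 2) (by simp) (by simp)
      (by simp [beta]) (by simp [beta]) (by simp) (by simp) (by simp [beta]) (by simp)
  have e₈ : MeetsInTwo (beta (1 : ZMod v) 3) {pt 2 (-3), pt 0 1, pt 2 (-2)} :=
    meetsInTwo_of_mem (p := pt 0 1) (q := pt 2 (-3)) (r := pt 1 3) (by simp) (by simp)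
      (by simp [beta]) (by simp [beta]) (by simp) (by simp) (by simp [beta]) (by simp)
  have b : IsWalkList MeetsInTwo (beta (2 : ZMod v) 3) (beta 1 1)
      (run 2 3 (w + 4) ++ [beta 2 0, alpha 1 0, beta 1 1]) :=
    (isWalkList_run 2 (w + 3) rfl).append
      (alpha_meets_beta _ _ (by push_cast; linear_combination hw))
      (.cons (beta_meets_alpha_sub_one _ _ (by norm_num))
      (.cons (alpha_meets_beta _ _ (by norm_num)) (.singleton _)))
  exact .cons (alpha_meets_beta _ _ (by norm_num)) ((isWalkList_run 2 0 rfl).append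
    (alpha_meets_beta _ _ (by norm_num)) (.cons e₁ (.cons e₂ ((hl.walk.map_level 2).append
    e₃.symm (.cons e₄.symm (.cons (hs _ _ (corner01_meets_corner12 _)) (.cons
    (beta_meets_corner01 _).symm ((b.reverse hs).append (corner02_meets_beta _ (by norm_num)).symm
    (.cons (corner02_meets_corner01 _) (.cons e₅ (.cons e₆.symm (.cons e₇ (.cons e₈.symm
    ((isWalkList_run 1 (w + 3) rfl).append
    (alpha_meets_beta _ _ (by push_cast; linear_combination hw)) (.singleton _)))))))))))))))

theorem card_of_mem_gadgetTwo [Fact (1 < v)] (h2 : (2 : ZMod v) ≠ 0) {F E : Finset (ZMod v)}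
    (hl : IsPuncturedWalk (-3) (-4) (-2) F E l) : ∀ C ∈ gadgetTwo w l, C.card = 3 := by
  have h1 : (1 : ZMod v) ≠ 0 := one_ne_zero
  have h34 : (-3 : ZMod v) ≠ -4 := fun h => h1 (by linear_combination h)
  have h42 : (-4 : ZMod v) ≠ -2 := fun h => h2 (by linear_combination -h)
  have h32 : (-3 : ZMod v) ≠ -2 := fun h => h1 (by linear_combination -h)
  have c₁ : ({pt 2 (-3), pt 2 (-4), pt 1 2} : Finset (Point v)).card = 3 :=
    card_triple (by simpa using h34) (by simp) (by simp)
  have c₂ : ({pt 2 (-3), pt 0 1, pt 2 (-2)} : Finset (Point v)).card = 3 :=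
    card_triple (by simp) (by simpa using h32) (by simp)
  have c₃ : (inf (pt 2 (-4)) (pt 2 (-2)) : Finset (Point v)).card = 3 := card_inf (Or.inr h42)
  have c₄ : (inf (pt 0 1) (pt 1 2) : Finset (Point v)).card = 3 := card_inf (by simp)
  simp only [gadgetTwo, List.forall_mem_cons, List.forall_mem_append, List.mem_reverse,
    List.forall_mem_map, Finset.card_map, card_alpha, card_beta, card_corner01, card_corner12,
    card_corner02, c₁, c₂, c₃, c₄, List.not_mem_nil, IsEmpty.forall_iff, implies_true, and_true,
    true_and, forall_mem_run_card_iff]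
  exact hl.card_eq

end two

section one

variable (w : ℕ) (l : List (Finset (ZMod v)))

/-- The part of the cycle in rows `0`, `-1`, after the trade that joins the walk `l` through
level `1` to it. -/
def gadgetOne : List (Finset (Point v)) :=
  corner12 0 :: inf (pt 1 (-1)) (pt 1 0) :: corner01 (-1) ::
    ((run 0 (-1) 1 ++ beta 0 0 :: alpha (-1) 0 :: (run (-1) 1 (w + 5) ++
      [beta (-1) (-1)])).reverse ++
    {pt 1 (-2), pt 1 (-1), pt 2 2} :: (l.map (Finset.map (level 1)) ++
    {pt 1 (-2), pt 0 0, pt 1 0} :: ((run 0 1 (w + 4) ++ [beta 0 (-2)]).reverse ++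
    [corner02 0, inf (pt 0 0) (pt 2 2), corner02 (-1), beta (-1) 0])))

/-- Here `corner01 0`, `alpha 0 (-2)` and `corner12 (-1)` are removed. As `alpha 0 0` is itself
replaced by corners, the walk enters row `0` at `corner12 0`, which meets `beta 1 0`. -/
theorem isWalkList_gadgetOne [Fact (1 < v)] (hw : (w : ZMod v) + 7 = 0)
    (h2 : (2 : ZMod v) ≠ 0) {F E : Finset (ZMod v)}
    (hl : IsPuncturedWalk (-1) (-2) 0 F E l) :
    IsWalkList MeetsInTwo (corner12 (0 : ZMod v)) (beta (-1) 0) (gadgetOne w l) := by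
  have h1 : (1 : ZMod v) ≠ 0 := one_ne_zero
  have h21 : (-2 : ZMod v) ≠ -1 := fun h => h1 (by linear_combination -h)
  have h20 : (-2 : ZMod v) ≠ 0 := fun h => h2 (by linear_combination -h)
  have h10 : (-1 : ZMod v) ≠ 0 := fun h => h1 (by linear_combination -h)
  have hs : ∀ x y : Finset (Point v), MeetsInTwo x y → MeetsInTwo y x := fun _ _ h => h.symm
  have e₁ : MeetsInTwo (corner12 (0 : ZMod v)) (inf (pt 1 (-1)) (pt 1 0)) :=
    meetsInTwo_of_mem (p := none) (q := pt 1 0) (r := pt 2 (-2 * 0)) (by simp) (by simp)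
      (by simp [corner12, inf]) (by simp [corner12, inf]) (by simp [inf]) (by simp [inf])
      (by simp [corner12, inf]) (by simp [inf])
  have e₂ : MeetsInTwo (corner01 (-1 : ZMod v)) (inf (pt 1 (-1)) (pt 1 0)) :=
    meetsInTwo_of_mem (p := none) (q := pt 1 (-1)) (r := pt 0 (-1)) (by simp) (by simp)
      (by simp [corner01, inf]) (by simp [corner01, inf]) (by simp [inf]) (by simp [inf])
      (by simp [corner01, inf]) (by simp [inf])
  have e₃ : MeetsInTwo (beta (0 : ZMod v) (-1)) {pt 1 (-2), pt 1 (-1), pt 2 2} :=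
    meetsInTwo_of_mem (p := pt 1 (-1)) (q := pt 2 2) (r := pt 0 0) (by simp) (by simp)
      (by simp [beta]) (by simp [beta]; norm_num) (by simp) (by simp) (by simp [beta]) (by simp)
  have e₄ : MeetsInTwo ({pt 1 (-2), pt 1 (-1), pt 2 2} : Finset (Point v))
      (F.map (level 1)) :=
    meetsInTwo_of_mem (p := pt 1 (-2)) (q := pt 1 (-1)) (r := pt 2 2)
      (card_triple (by simpa using h21) (by simp) (by simp))
      (by simpa using h21) (by simp) (by simp) (by simp [-Finset.mem_map, hl.middle_mem_first])
      (by simp [-Finset.mem_map, hl.left_mem_first]) (by simp) (by simp [-Finset.mem_map])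
  have e₅ : MeetsInTwo ({pt 1 (-2), pt 0 0, pt 1 0} : Finset (Point v)) (E.map (level 1)) :=
    meetsInTwo_of_mem (p := pt 1 (-2)) (q := pt 1 0) (r := pt 0 0)
      (card_triple (by simp) (by simpa using h20) (by simp))
      (by simpa using h20) (by simp) (by simp) (by simp [-Finset.mem_map, hl.middle_mem_last])
      (by simp [-Finset.mem_map, hl.right_mem_last]) (by simp) (by simp [-Finset.mem_map])
  have e₆ : MeetsInTwo (beta (0 : ZMod v) (-2)) {pt 1 (-2), pt 0 0, pt 1 0} :=
    meetsInTwo_of_mem (p := pt 1 (-2)) (q := pt 0 0) (r := pt 2 (1 - 0 - -2)) (by simp) (by simp)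
      (by simp [beta]) (by simp [beta]) (by simp) (by simp) (by simp [beta]) (by simp)
  have e₇ : MeetsInTwo (beta (0 : ZMod v) 1) (corner02 0) :=
    meetsInTwo_of_mem (p := pt 0 0) (q := pt 2 (-2 * 0)) (r := pt 1 1) (by simp) (by simp)
      (by simp [beta]) (by simp [beta]) (by simp [corner02, inf]) (by simp [corner02, inf])
      (by simp [beta]) (by simp [corner02, inf])
  have e₈ : MeetsInTwo (corner02 (0 : ZMod v)) (inf (pt 0 0) (pt 2 2)) :=
    meetsInTwo_of_mem (p := none) (q := pt 0 0) (r := pt 2 (-2 * 0)) (by simp) (by simp)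
      (by simp [corner02, inf]) (by simp [corner02, inf]) (by simp [inf]) (by simp [inf])
      (by simp [corner02, inf]) (by simp [inf, h2.symm])
  have e₉ : MeetsInTwo (corner02 (-1 : ZMod v)) (inf (pt 0 0) (pt 2 2)) :=
    meetsInTwo_of_mem (p := none) (q := pt 2 2) (r := pt 0 (-1)) (by simp) (by simp)
      (by simp [corner02, inf]) (by simp [corner02, inf]) (by simp [inf]) (by simp [inf])
      (by simp [corner02, inf]) (by simp [inf])
  have b₁ : IsWalkList MeetsInTwo (beta (0 : ZMod v) (-1)) (beta (-1) (-1))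
      (run 0 (-1) 1 ++ beta 0 0 :: alpha (-1) 0 :: (run (-1) 1 (w + 5) ++
      [beta (-1) (-1)])) :=
    (isWalkList_run 0 0 rfl).append (alpha_meets_beta _ _ (by norm_num))
      (.cons (beta_meets_alpha_sub_one _ _ (by norm_num))
      (.cons (alpha_meets_beta _ _ (by norm_num)) ((isWalkList_run (-1) (w + 4) rfl).append
      (alpha_meets_beta _ _ (by push_cast; linear_combination hw)) (.singleton _))))
  have b₂ : IsWalkList MeetsInTwo (beta (0 : ZMod v) 1) (beta 0 (-2))
      (run 0 1 (w + 4) ++ [beta 0 (-2)]) :=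
    (isWalkList_run 0 (w + 3) rfl).append
      (alpha_meets_beta _ _ (by push_cast; linear_combination hw)) (.singleton _)
  exact .cons e₁ (.cons e₂.symm (.cons (beta_meets_corner01 _).symm ((b₁.reverse hs).append e₃
    (.cons e₄ ((hl.walk.map_level 1).append e₅.symm (.cons e₆.symm ((b₂.reverse hs).append e₇
    (.cons e₈ (.cons e₉.symm (.cons (corner02_meets_beta _ (by norm_num))
    (.singleton _)))))))))))

theorem card_of_mem_gadgetOne [Fact (1 < v)] (h2 : (2 : ZMod v) ≠ 0) {F E : Finset (ZMod v)}
    (hl : IsPuncturedWalk (-1) (-2) 0 F E l) : ∀ C ∈ gadgetOne w l, C.card = 3 := by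
  have h1 : (1 : ZMod v) ≠ 0 := one_ne_zero
  have h21 : (-2 : ZMod v) ≠ -1 := fun h => h1 (by linear_combination -h)
  have h20 : (-2 : ZMod v) ≠ 0 := fun h => h2 (by linear_combination -h)
  have h10 : (-1 : ZMod v) ≠ 0 := fun h => h1 (by linear_combination -h)
  have c₁ : ({pt 1 (-2), pt 1 (-1), pt 2 2} : Finset (Point v)).card = 3 :=
    card_triple (by simpa using h21) (by simp) (by simp)
  have c₂ : ({pt 1 (-2), pt 0 0, pt 1 0} : Finset (Point v)).card = 3 :=
    card_triple (by simp) (by simpa using h20) (by simp)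
  have c₃ : (inf (pt 1 (-1)) (pt 1 0) : Finset (Point v)).card = 3 := card_inf (Or.inr h10)
  have c₄ : (inf (pt 0 0) (pt 2 2) : Finset (Point v)).card = 3 := card_inf (by simp)
  simp only [gadgetOne, List.forall_mem_cons, List.forall_mem_append, List.mem_reverse,
    List.forall_mem_map, Finset.card_map, card_alpha, card_beta, card_corner01, card_corner12,
    card_corner02, c₁, c₂, c₃, c₄, List.not_mem_nil, IsEmpty.forall_iff, implies_true, and_true,
    true_and, forall_mem_run_card_iff]
  exact hl.card_eq

end one

end Point

/-! ### Pair counts of rows and gadgets -/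

theorem covers_triple {V : Type*} [DecidableEq V] {p q : V} (hpq : p ≠ q) {a b c : V}
    (hab : a ≠ b) (hac : a ≠ c) (hbc : b ≠ c) :
    covers p q {a, b, c} = covers p q {a, b} + covers p q {a, c} + covers p q {b, c} := by
  simp only [covers, Finset.mem_insert, Finset.mem_singleton]
  grind

namespace Point

variable {v : ℕ} {p q : Point v}

theorem natCast_add_seven {w : ℕ} (hv : w + 7 = v) : (w : ZMod v) + 7 = 0 := by
  have h : ((w + 7 : ℕ) : ZMod v) = (v : ZMod v) := by rw [hv]
  rwa [ZMod.natCast_self, Nat.cast_add, Nat.cast_ofNat] at h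

theorem covers_alpha (hpq : p ≠ q) (x y : ZMod v) :
    covers p q (alpha x y) = covers p q {pt 0 x, pt 1 y} +
      covers p q {pt 0 x, pt 2 (-x - y)} + covers p q {pt 1 y, pt 2 (-x - y)} :=
  covers_triple hpq (by simp) (by simp) (by simp)

theorem covers_beta (hpq : p ≠ q) (x y : ZMod v) :
    covers p q (beta x y) = covers p q {pt 0 x, pt 1 y} +
      covers p q {pt 0 x, pt 2 (1 - x - y)} + covers p q {pt 1 y, pt 2 (1 - x - y)} :=
  covers_triple hpq (by simp) (by simp) (by simp)

theorem covers_inf (hpq : p ≠ q) {i j : Fin 3} {x y : ZMod v} (h : i ≠ j ∨ x ≠ y) :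
    covers p q (inf (pt i x) (pt j y)) = covers p q {none, pt i x} +
      covers p q {none, pt j y} + covers p q {pt i x, pt j y} :=
  covers_triple hpq (by simp) (by simp) (by simp; tauto)

variable (p q)

/-- The number of times the triples of a row of the two Latin squares cover `p`, `q`. -/
def rowCovers [NeZero v] (x : ZMod v) : ℕ :=
  ∑ y : ZMod v, (covers p q (alpha x y) + covers p q (beta x y))

/-- Twice the number of pairs `p`, `q` formed by infinity and a point of `alpha x x`. -/
def infCovers (x : ZMod v) : ℕ :=
  2 * (covers p q {none, pt 0 x} + covers p q {none, pt 1 x} + covers p q {none, pt 2 (-2 * x)})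

variable {p q}

theorem covers_corner01 (hpq : p ≠ q) (x : ZMod v) :
    covers p q (corner01 x) = covers p q {none, pt 0 x} + covers p q {none, pt 1 x} +
      covers p q {pt 0 x, pt 1 x} :=
  covers_inf hpq (by simp)

theorem covers_corner02 (hpq : p ≠ q) (x : ZMod v) :
    covers p q (corner02 x) = covers p q {none, pt 0 x} + covers p q {none, pt 2 (-2 * x)} +
      covers p q {pt 0 x, pt 2 (-2 * x)} :=
  covers_inf hpq (by simp)

theorem covers_corner12 (hpq : p ≠ q) (x : ZMod v) :
    covers p q (corner12 x) = covers p q {none, pt 1 x} + covers p q {none, pt 2 (-2 * x)} +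
      covers p q {pt 1 x, pt 2 (-2 * x)} :=
  covers_inf hpq (by simp)

/-- The corners and `alpha x x` are the four faces of a tetrahedron with apex `none`: each base edge
is on one corner, each edge at the apex on two. -/
theorem covers_corners (hpq : p ≠ q) (x : ZMod v) :
    covers p q (corner01 x) + covers p q (corner12 x) + covers p q (corner02 x) =
      covers p q (alpha x x) + infCovers p q x := by
  rw [covers_corner01 hpq, covers_corner02 hpq, covers_corner12 hpq, covers_alpha hpq, infCovers,
    show -x - x = -2 * x by ring]
  ring

theorem pairCount_run (x y : ZMod v) (n : ℕ) :
    pairCount p q (run x y n) =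
      ∑ i ∈ Finset.range n, (covers p q (alpha x (y + i)) + covers p q (beta x (y + i))) := by
  induction n generalizing y with
  | zero => simp [run]
  | succ n ih =>
    rw [run, pairCount_cons, pairCount_cons, ih, Finset.sum_range_succ']
    simp only [Nat.cast_add, Nat.cast_one, Nat.cast_zero, add_zero, add_assoc, add_comm (1 : ZMod v)]
    ring

theorem sum_range_add_natCast {M : Type*} [AddCommMonoid M] [NeZero v] (f : ZMod v → M)
    (y : ZMod v) : ∑ i ∈ Finset.range v, f (y + i) = ∑ z, f z := by
  rw [← Equiv.sum_comp (Equiv.addLeft y) f]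
  refine Finset.sum_bij (fun i _ => (i : ZMod v)) (by simp) ?_ ?_ (by simp)
  · intro i hi j hj h
    rw [ZMod.natCast_eq_natCast_iff'] at h
    rwa [Nat.mod_eq_of_lt (Finset.mem_range.1 hi), Nat.mod_eq_of_lt (Finset.mem_range.1 hj)] at h
  · intro z _
    exact ⟨z.val, Finset.mem_range.2 (ZMod.val_lt z), ZMod.natCast_zmod_val z⟩

theorem pairCount_run_full [NeZero v] (x y : ZMod v) {n : ℕ} (hn : n = v) :
    pairCount p q (run x y n) = rowCovers p q x := by
  rw [hn, pairCount_run, rowCovers,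
    sum_range_add_natCast (fun z => covers p q (alpha x z) + covers p q (beta x z))]

theorem pairCount_run_add (x y : ZMod v) {z : ZMod v} (m n : ℕ) (h : y + m = z) :
    pairCount p q (run x y (m + n)) = pairCount p q (run x y m) + pairCount p q (run x z n) := by
  rw [run_add, pairCount_append, h]

theorem pairCount_run_one (x y : ZMod v) :
    pairCount p q (run x y 1) = covers p q (alpha x y) + covers p q (beta x y) := by
  simp [run, add_comm]

theorem pairCount_row [NeZero v] (hpq : p ≠ q) {x : ZMod v} {m n : ℕ} (hmn : m + n + 4 = v)
    (hm : (m : ZMod v) + 2 = x) :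
    pairCount p q (row x m n) = rowCovers p q x + infCovers p q x := by
  -- The full row splits into column `0`, columns before `x`, column `x`, and columns after `x`.
  have h := pairCount_run_full (p := p) (q := q) x 0
    (show 1 + ((m + 1) + (1 + (n + 1))) = v by omega)
  rw [pairCount_run_add (z := 1) x 0 1 _ (by simp),
    pairCount_run_add (z := x) x 1 (m + 1) _ (by push_cast; linear_combination hm),
    pairCount_run_add (z := x + 1) x x 1 _ (by simp), pairCount_run_one, pairCount_run_one] at h
  have h' := covers_corners hpq x
  simp only [row, pairCount_cons, pairCount_append, pairCount_nil]
  omega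

variable (p q) in
/-- Twice the indicator of `p` and `q` both being on level `i`. -/
def levelCovers [NeZero v] (i : Fin 3) : ℕ := 2 * covers p q (Finset.univ.map (level i))

/-- If `p` and `q` are not both on level `i`, every term vanishes; otherwise this is the count in
the punctured walk. -/
theorem pairCount_map_level [NeZero v] (hpq : p ≠ q) (i : Fin 3) {a b c : ZMod v}
    {F E : Finset (ZMod v)} {l : List (Finset (ZMod v))} (hl : IsPuncturedWalk a b c F E l) :
    pairCount p q (l.map (Finset.map (level i))) + covers p q {pt i a, pt i b, pt i c} =
      levelCovers p q i := by
  have hS : ({pt i a, pt i b, pt i c} : Finset (Point v)) =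
      ({a, b, c} : Finset (ZMod v)).map (level i) := by simp
  rw [hS, levelCovers]
  by_cases h : p ∈ Finset.univ.map (level i) ∧ q ∈ Finset.univ.map (level i)
  · obtain ⟨hp, hq⟩ := h
    obtain ⟨x, -, rfl⟩ := Finset.mem_map.1 hp
    obtain ⟨y, -, rfl⟩ := Finset.mem_map.1 hq
    have hxy : x ≠ y := fun h => hpq (by rw [h])
    rw [pairCount_map]
    have := hl.pairCount_eq x y hxy
    simp only [covers, Finset.mem_map'] at this ⊢
    simpa using this
  · have hsub : ∀ S : Finset (ZMod v), ¬ (p ∈ S.map (level i) ∧ q ∈ S.map (level i)) := by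
      intro S hS
      exact h ⟨Finset.map_subset_map.2 (Finset.subset_univ S) hS.1,
        Finset.map_subset_map.2 (Finset.subset_univ S) hS.2⟩
    have h₁ : pairCount p q (l.map (Finset.map (level i))) = 0 := by
      rw [pairCount, List.countP_eq_zero]
      intro C hC
      obtain ⟨S, -, rfl⟩ := List.mem_map.1 hC
      simpa using hsub S
    rw [h₁, covers, covers, if_neg (hsub _), if_neg h]

theorem pairCount_gadgetZero [Fact (1 < v)] (hpq : p ≠ q) {w : ℕ} (hv : w + 7 = v)
    (h2 : (2 : ZMod v) ≠ 0) {F E : Finset (ZMod v)} {l : List (Finset (ZMod v))}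
    (hl : IsPuncturedWalk 5 4 3 F E l) :
    pairCount p q (gadgetZero w l) = rowCovers p q 5 + infCovers p q 5 +
      (rowCovers p q 4 + infCovers p q 4) + (rowCovers p q 3 + infCovers p q 3) +
      levelCovers p q 0 := by
  have h1 : (1 : ZMod v) ≠ 0 := one_ne_zero
  have h54 : (5 : ZMod v) ≠ 4 := fun h => h1 (by linear_combination h)
  have h43 : (4 : ZMod v) ≠ 3 := fun h => h1 (by linear_combination h)
  have h53 : (5 : ZMod v) ≠ 3 := fun h => h2 (by linear_combination h)
  have r₅ : rowCovers p q (5 : ZMod v) = _ := (pairCount_run_full 5 0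
    (show 1 + (2 + (1 + (1 + (1 + (w + 1))))) = v by omega)).symm
  rw [pairCount_run_add (z := 1) 5 0 1 _ (by norm_num),
    pairCount_run_add (z := 3) 5 1 2 _ (by norm_num),
    pairCount_run_add (z := 4) 5 3 1 _ (by norm_num),
    pairCount_run_add (z := 5) 5 4 1 _ (by norm_num),
    pairCount_run_add (z := 6) 5 5 1 _ (by norm_num)] at r₅
  have r₄ : rowCovers p q (4 : ZMod v) = _ := (pairCount_run_full 4 0
    (show 1 + (3 + (1 + (w + 2))) = v by omega)).symm
  rw [pairCount_run_add (z := 1) 4 0 1 _ (by norm_num),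
    pairCount_run_add (z := 4) 4 1 3 _ (by norm_num),
    pairCount_run_add (z := 5) 4 4 1 _ (by norm_num)] at r₄
  have r₃ : rowCovers p q (3 : ZMod v) = _ := (pairCount_run_full 3 0
    (show 1 + (2 + (1 + (w + 3))) = v by omega)).symm
  rw [pairCount_run_add (z := 1) 3 0 1 _ (by norm_num),
    pairCount_run_add (z := 3) 3 1 2 _ (by norm_num),
    pairCount_run_add (z := 4) 3 3 1 _ (by norm_num)] at r₃
  have t₅ := covers_corners hpq (5 : ZMod v)
  have t₄ := covers_corners hpq (4 : ZMod v)
  have t₃ := covers_corners hpq (3 : ZMod v)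
  have hb := pairCount_map_level hpq 0 hl
  -- The Pasch switch on `none`, `pt 0 5`, `pt 0 4`, `pt 0 3`, `pt 1 3`, `pt 2 (-8)`: both
  -- quadruples have the same twelve edges.
  have trade : covers p q {pt 0 5, pt 1 3, pt 0 3} + covers p q {pt 0 5, pt 0 4, pt 2 (-8)} +
      covers p q (inf (pt 0 4) (pt 0 3)) + covers p q (inf (pt 1 3) (pt 2 (-8))) =
      covers p q (alpha 5 3) + covers p q (corner02 4) + covers p q (corner01 3) +
      covers p q {pt 0 5, pt 0 4, pt 0 3} := by
    rw [covers_triple hpq (by simp) (by simp [h53]) (by simp),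
      covers_triple hpq (by simp [h54]) (by simp) (by simp), covers_inf hpq (by simp [h43]),
      covers_inf hpq (by simp), covers_alpha hpq, covers_corner02 hpq, covers_corner01 hpq,
      covers_triple hpq (by simp [h54]) (by simp [h53]) (by simp [h43]),
      show (-5 - 3 : ZMod v) = -8 by norm_num, show (-2 * 4 : ZMod v) = -8 by norm_num,
      Finset.pair_comm (pt 1 3) (pt 0 3)]
    omega
  simp only [pairCount_run_one] at r₅ r₄ r₃
  simp only [gadgetZero, pairCount_cons, pairCount_append, pairCount_nil, pairCount_reverse,
    pairCount_run_one]
  linarith only [r₅, r₄, r₃, t₅, t₄, t₃, hb, trade]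

theorem pairCount_gadgetTwo [Fact (1 < v)] (hpq : p ≠ q) {w : ℕ} (hv : w + 7 = v)
    (h2 : (2 : ZMod v) ≠ 0) {F E : Finset (ZMod v)} {l : List (Finset (ZMod v))}
    (hl : IsPuncturedWalk (-3) (-4) (-2) F E l) :
    pairCount p q (gadgetTwo w l) = rowCovers p q 2 + infCovers p q 2 +
      (rowCovers p q 1 + infCovers p q 1) + levelCovers p q 2 := by
  have h1 : (1 : ZMod v) ≠ 0 := one_ne_zero
  have h34 : (-3 : ZMod v) ≠ -4 := fun h => h1 (by linear_combination h)
  have h42 : (-4 : ZMod v) ≠ -2 := fun h => h2 (by linear_combination -h)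
  have h32 : (-3 : ZMod v) ≠ -2 := fun h => h1 (by linear_combination -h)
  have r₂ : rowCovers p q (2 : ZMod v) = _ := (pairCount_run_full 2 0
    (show 1 + (1 + (1 + (w + 4))) = v by omega)).symm
  rw [pairCount_run_add (z := 1) 2 0 1 _ (by norm_num),
    pairCount_run_add (z := 2) 2 1 1 _ (by norm_num),
    pairCount_run_add (z := 3) 2 2 1 _ (by norm_num)] at r₂
  have r₁ : rowCovers p q (1 : ZMod v) = _ := (pairCount_run_full 1 0
    (show 1 + (1 + (1 + (w + 4))) = v by omega)).symm
  rw [pairCount_run_add (z := 1) 1 0 1 _ (by norm_num),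
    pairCount_run_add (z := 2) 1 1 1 _ (by norm_num),
    pairCount_run_add (z := 3) 1 2 1 _ (by norm_num)] at r₁
  have t₂ := covers_corners hpq (2 : ZMod v)
  have t₁ := covers_corners hpq (1 : ZMod v)
  have hb := pairCount_map_level hpq 2 hl
  -- The same switch, with `alpha 1 2` as the triple avoiding both `none` and the block on level
  -- `2`.
  have trade : covers p q {pt 2 (-3), pt 2 (-4), pt 1 2} +
      covers p q {pt 2 (-3), pt 0 1, pt 2 (-2)} + covers p q (inf (pt 2 (-4)) (pt 2 (-2))) +
      covers p q (inf (pt 0 1) (pt 1 2)) =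
      covers p q (alpha 1 2) + covers p q (corner12 2) + covers p q (corner02 1) +
      covers p q {pt 2 (-3), pt 2 (-4), pt 2 (-2)} := by
    rw [covers_triple hpq (by simpa using h34) (by simp) (by simp),
      covers_triple hpq (by simp) (by simpa using h32) (by simp), covers_inf hpq (Or.inr h42),
      covers_inf hpq (by simp), covers_alpha hpq, covers_corner12 hpq, covers_corner02 hpq,
      covers_triple hpq (by simpa using h34) (by simpa using h32) (by simpa using h42),
      show (-1 - 2 : ZMod v) = -3 by norm_num, show (-2 * 2 : ZMod v) = -4 by norm_num,
      show (-2 * 1 : ZMod v) = -2 by norm_num, Finset.pair_comm (pt 2 (-3)) (pt 1 2),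
      Finset.pair_comm (pt 2 (-4)) (pt 1 2), Finset.pair_comm (pt 2 (-3)) (pt 0 1)]
    omega
  simp only [pairCount_run_one] at r₂ r₁
  simp only [gadgetTwo, pairCount_cons, pairCount_append, pairCount_nil, pairCount_reverse,
    pairCount_run_one]
  linarith only [r₂, r₁, t₂, t₁, hb, trade]

theorem pairCount_gadgetOne [Fact (1 < v)] (hpq : p ≠ q) {w : ℕ} (hv : w + 7 = v)
    (h2 : (2 : ZMod v) ≠ 0) {F E : Finset (ZMod v)} {l : List (Finset (ZMod v))}
    (hl : IsPuncturedWalk (-1) (-2) 0 F E l) :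
    pairCount p q (gadgetOne w l) = rowCovers p q 0 + infCovers p q 0 +
      (rowCovers p q (-1) + infCovers p q (-1)) + levelCovers p q 1 := by
  have h1 : (1 : ZMod v) ≠ 0 := one_ne_zero
  have hw := natCast_add_seven hv
  have h21 : (-2 : ZMod v) ≠ -1 := fun h => h1 (by linear_combination -h)
  have h20 : (-2 : ZMod v) ≠ 0 := fun h => h2 (by linear_combination -h)
  have h10 : (-1 : ZMod v) ≠ 0 := fun h => h1 (by linear_combination -h)
  have r₀ : rowCovers p q (0 : ZMod v) = _ := (pairCount_run_full 0 0
    (show 1 + ((w + 4) + (1 + 1)) = v by omega)).symm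
  rw [pairCount_run_add (z := 1) 0 0 1 _ (by norm_num),
    pairCount_run_add (z := -2) 0 1 (w + 4) _ (by push_cast; linear_combination hw),
    pairCount_run_add (z := -1) 0 (-2) 1 _ (by norm_num)] at r₀
  have r₁ : rowCovers p q (-1 : ZMod v) = _ := (pairCount_run_full (-1) 0
    (show 1 + ((w + 5) + 1) = v by omega)).symm
  rw [pairCount_run_add (z := 1) (-1) 0 1 _ (by norm_num),
    pairCount_run_add (z := -1) (-1) 1 (w + 5) _ (by push_cast; linear_combination hw)] at r₁
  have t₀ := covers_corners hpq (0 : ZMod v)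
  have t₁ := covers_corners hpq (-1 : ZMod v)
  have hb := pairCount_map_level hpq 1 hl
  -- The same switch, with `alpha 0 (-2)` in that role.
  have trade : covers p q {pt 1 (-2), pt 1 (-1), pt 2 2} +
      covers p q {pt 1 (-2), pt 0 0, pt 1 0} + covers p q (inf (pt 1 (-1)) (pt 1 0)) +
      covers p q (inf (pt 0 0) (pt 2 2)) =
      covers p q (alpha 0 (-2)) + covers p q (corner12 (-1)) + covers p q (corner01 0) +
      covers p q {pt 1 (-1), pt 1 (-2), pt 1 0} := by
    rw [covers_triple hpq (by simpa using h21) (by simp) (by simp),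
      covers_triple hpq (by simp) (by simpa using h20) (by simp), covers_inf hpq (Or.inr h10),
      covers_inf hpq (by simp), covers_alpha hpq, covers_corner12 hpq, covers_corner01 hpq,
      covers_triple hpq (by simpa using h21.symm) (by simp) (by simpa using h20),
      show (-0 - -2 : ZMod v) = 2 by norm_num, show (-2 * -1 : ZMod v) = 2 by norm_num,
      Finset.pair_comm (pt 1 (-2)) (pt 1 (-1)), Finset.pair_comm (pt 1 (-2)) (pt 0 0)]
    omega
  simp only [pairCount_run_one] at r₀ r₁
  simp only [gadgetOne, pairCount_cons, pairCount_append, pairCount_nil, pairCount_reverse,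
    pairCount_run_one]
  linarith only [r₀, r₁, t₀, t₁, hb, trade]

end Point

/-! ### Every pair is covered twice in total -/

theorem covers_pair {V : Type*} [DecidableEq V] {p q : V} (hpq : p ≠ q) (a b : V) :
    covers p q {a, b} = (if p = a ∧ q = b then 1 else 0) + (if p = b ∧ q = a then 1 else 0) := by
  simp only [covers, Finset.mem_insert, Finset.mem_singleton]
  grind

namespace Point

variable {v : ℕ}

theorem eq_none_or_eq_pt (p : Point v) :
    p = none ∨ (∃ x, p = pt 0 x) ∨ (∃ x, p = pt 1 x) ∨ ∃ x, p = pt 2 x := by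
  obtain _ | ⟨i, x⟩ := p
  · exact Or.inl rfl
  · fin_cases i
    · exact Or.inr (Or.inl ⟨x, rfl⟩)
    · exact Or.inr (Or.inr (Or.inl ⟨x, rfl⟩))
    · exact Or.inr (Or.inr (Or.inr ⟨x, rfl⟩))

section sums

variable [NeZero v] {p q : Point v}

/-- The three groups are the kinds of pairs: across levels, through `none`, within a level. Each
pair is of exactly one kind. -/
theorem sum_covers_eq_one (hpq : p ≠ q) :
    ((∑ x : ZMod v, ∑ y : ZMod v, covers p q {pt 0 x, pt 1 y}) +
      (∑ x : ZMod v, ∑ y : ZMod v, covers p q {pt 0 x, pt 2 y}) +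
      ∑ x : ZMod v, ∑ y : ZMod v, covers p q {pt 1 x, pt 2 y}) +
    ((∑ x : ZMod v, covers p q {none, pt 0 x}) + (∑ x : ZMod v, covers p q {none, pt 1 x}) +
      ∑ x : ZMod v, covers p q {none, pt 2 x}) +
    (covers p q (Finset.univ.map (level 0)) + covers p q (Finset.univ.map (level 1)) +
      covers p q (Finset.univ.map (level 2))) = 1 := by
  have hc : ∀ i, covers p q (Finset.univ.map (level i)) =
      if p ∈ Finset.univ.map (level i) ∧ q ∈ Finset.univ.map (level i) then 1 else 0 :=
    fun _ => rfl
  simp only [covers_pair hpq, hc]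
  rcases eq_none_or_eq_pt p with rfl | ⟨x, rfl⟩ | ⟨x, rfl⟩ | ⟨x, rfl⟩ <;>
  rcases eq_none_or_eq_pt q with rfl | ⟨y, rfl⟩ | ⟨y, rfl⟩ | ⟨y, rfl⟩ <;>
  first
  | exact absurd rfl hpq
  | simp [-Finset.mem_map, pt_mem_map_level, ite_and]

theorem sum_sub_right (f : ZMod v → ℕ) (s : ZMod v) : ∑ y, f (s - y) = ∑ y, f y :=
  Equiv.sum_comp (Equiv.subLeft s) f

/-- Any two entries of a triple with coordinate sum `s` determine the third, so each cross-level
pair occurs once. -/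
theorem sum_covers_latin (s : ZMod v) :
    ∑ x : ZMod v, ∑ y : ZMod v, (covers p q {pt 0 x, pt 1 y} +
      covers p q {pt 0 x, pt 2 (s - x - y)} + covers p q {pt 1 y, pt 2 (s - x - y)}) =
    (∑ x : ZMod v, ∑ y : ZMod v, covers p q {pt 0 x, pt 1 y}) +
      (∑ x : ZMod v, ∑ y : ZMod v, covers p q {pt 0 x, pt 2 y}) +
      ∑ x : ZMod v, ∑ y : ZMod v, covers p q {pt 1 x, pt 2 y} := by
  simp only [Finset.sum_add_distrib]
  congr 1
  · congr 1
    refine Finset.sum_congr rfl fun x _ => ?_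
    exact sum_sub_right (fun z => covers p q {pt 0 x, pt 2 z}) (s - x)
  · rw [Finset.sum_comm]
    refine Finset.sum_congr rfl fun y _ => ?_
    simp only [sub_right_comm s _ y]
    exact sum_sub_right (fun z => covers p q {pt 1 y, pt 2 z}) (s - y)

theorem sum_rowCovers (hpq : p ≠ q) :
    ∑ x : ZMod v, rowCovers p q x =
    2 * ((∑ x : ZMod v, ∑ y : ZMod v, covers p q {pt 0 x, pt 1 y}) +
      (∑ x : ZMod v, ∑ y : ZMod v, covers p q {pt 0 x, pt 2 y}) +
      ∑ x : ZMod v, ∑ y : ZMod v, covers p q {pt 1 x, pt 2 y}) := by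
  have h₀ := sum_covers_latin (p := p) (q := q) 0
  simp only [zero_sub] at h₀
  have h₁ := sum_covers_latin (p := p) (q := q) 1
  simp only [rowCovers, covers_alpha hpq, covers_beta hpq]
  rw [two_mul]
  nth_rw 1 [← h₀]
  rw [← h₁]
  simp only [← Finset.sum_add_distrib]

theorem sum_infCovers (hodd : Odd v) :
    ∑ x : ZMod v, infCovers p q x =
    2 * ((∑ x : ZMod v, covers p q {none, pt 0 x}) + (∑ x : ZMod v, covers p q {none, pt 1 x}) +
      ∑ x : ZMod v, covers p q {none, pt 2 x}) := by
  obtain ⟨k, hk⟩ := hodd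
  have hk' : (2 * k + 1 : ZMod v) = 0 := by
    have h : ((2 * k + 1 : ℕ) : ZMod v) = (v : ZMod v) := by rw [hk]
    rw [ZMod.natCast_self] at h
    exact_mod_cast h
  have hinj : Function.Injective (fun x : ZMod v => -2 * x) := fun x y h => by
    simp only at h
    -- Modulo `2 * k + 1` the inverse of 2 is `k + 1`.
    linear_combination (-(k + 1 : ZMod v)) * h - (x - y) * hk'
  have h := (Finite.injective_iff_bijective.1 hinj).sum_comp
    (fun z => covers p q {none, pt 2 z})
  simp only [infCovers, ← Finset.mul_sum, Finset.sum_add_distrib]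
  rw [h]

theorem sum_all_covers (hpq : p ≠ q) (hodd : Odd v) :
    ∑ x : ZMod v, (rowCovers p q x + infCovers p q x) +
      (levelCovers p q 0 + levelCovers p q 1 + levelCovers p q 2) = 2 := by
  have h := sum_covers_eq_one hpq
  rw [Finset.sum_add_distrib, sum_rowCovers hpq, sum_infCovers hodd, levelCovers, levelCovers,
    levelCovers]
  omega

end sums

/-! ### Remaining rows and assembly -/

/-- The rows of the cycle that are not affected by the trades. -/
def freeRows (w : ℕ) : ℕ → List (Finset (Point v))
  | 0 => []
  | i + 1 => freeRows w i ++ row (-2 - (i : ZMod v)) (w + 3 - i) i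

theorem card_of_mem_freeRows (w n : ℕ) :
    ∀ C ∈ (freeRows w n : List (Finset (Point v))), C.card = 3 := by
  induction n with
  | zero => simp [freeRows]
  | succ n ih =>
    simp only [freeRows, row, List.forall_mem_cons, List.forall_mem_append, card_alpha, card_beta,
      card_corner01, card_corner12, card_corner02, List.not_mem_nil, IsEmpty.forall_iff,
      implies_true, and_true, forall_mem_run_card_iff]
    exact ih

theorem isWalkList_append_freeRows [Fact (1 < v)] {w n : ℕ} (hw : (w : ZMod v) + 7 = 0)
    (hn : n ≤ w) {B : Finset (Point v)} {l : List (Finset (Point v))}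
    (hl : IsWalkList MeetsInTwo B (beta (-1) 0) l) :
    IsWalkList MeetsInTwo B (beta (-1 - (n : ZMod v)) 0) (l ++ freeRows w n) := by
  induction n with
  | zero => simpa [freeRows] using hl
  | succ n ih =>
    rw [freeRows, ← List.append_assoc]
    rw [show (-1 - ((n + 1 : ℕ) : ZMod v)) = -2 - n by push_cast; ring]
    refine (ih (by omega)).append (beta_meets_alpha_sub_one _ _ (by ring))
      (isWalkList_row ?_ (by ring))
    rw [Nat.cast_sub (by omega)]
    push_cast
    linear_combination hw

theorem pairCount_freeRows [NeZero v] {p q : Point v} (hpq : p ≠ q) {w n : ℕ}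
    (hv : w + 7 = v) (hn : n ≤ w) :
    pairCount p q (freeRows w n) = ∑ i ∈ Finset.range n,
      (rowCovers p q (-2 - (i : ZMod v)) + infCovers p q (-2 - (i : ZMod v))) := by
  have hw := natCast_add_seven hv
  induction n with
  | zero => simp [freeRows]
  | succ n ih =>
    rw [freeRows, pairCount_append, ih (by omega), Finset.sum_range_succ,
      pairCount_row hpq (by omega)]
    rw [Nat.cast_sub (by omega)]
    push_cast
    linear_combination hw

theorem sum_eq_add_sum_range [NeZero v] {w : ℕ} (hv : w + 7 = v) (f : ZMod v → ℕ) :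
    ∑ x, f x = f 5 + f 4 + f 3 + f 2 + f 1 + f 0 + f (-1) +
      ∑ i ∈ Finset.range w, f (-2 - (i : ZMod v)) := by
  -- Negation lists the residues downwards from 5, the order in which the cycle visits the rows.
  have h := sum_range_add_natCast (fun z => f (-z)) (-5)
  rw [← show ∑ z, f (-z) = ∑ z, f z from Equiv.sum_comp (Equiv.neg (ZMod v)) f, ← h]
  have hr : Finset.range v = Finset.range (7 + w) := by rw [← hv, add_comm]
  rw [hr, Finset.sum_range_add]
  congr 1
  · simp only [Finset.sum_range_succ, Finset.sum_range_zero]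
    norm_num
  · refine Finset.sum_congr rfl fun i _ => congrArg f ?_
    push_cast
    ring

end Point

open Point

theorem theorem7p1 (v : ℕ) (hv : 7 ≤ v) (hodd : Odd v)
    (h : ∃ (V ι : Type) (_ : Fintype V) (_ : DecidableEq V) (_ : Fintype ι) (_ : DecidableEq ι)
      (B : ι → Finset V), IsTTS B v ∧ (blockIntersectionGraph 2 B).IsHamiltonian) :
    ∃ (V ι : Type) (_ : Fintype V) (_ : DecidableEq V) (_ : Fintype ι) (_ : DecidableEq ι)
      (B : ι → Finset V),
      IsTTS B (3 * v + 1) ∧ (blockIntersectionGraph 2 B).IsHamiltonian := by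
  obtain ⟨V, ι, _, _, _, _, B, hB, hH⟩ := h
  obtain ⟨B₀, B₁, B₂, l, hl, hB₁, hB₂, hlen, h3, hcount⟩ :=
    exists_block_list_of_isHamiltonian (by omega) hB hH
  obtain ⟨w, hw⟩ : ∃ w, w + 7 = v := ⟨v - 7, by omega⟩
  have hw' := natCast_add_seven hw
  have : Fact (1 < v) := ⟨by omega⟩
  have : NeZero v := ⟨by omega⟩
  have h1 : (1 : ZMod v) ≠ 0 := one_ne_zero
  have h2 : (2 : ZMod v) ≠ 0 := by
    intro h
    have : ((2 : ℕ) : ZMod v) = 0 := by exact_mod_cast h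
    rw [ZMod.natCast_eq_zero_iff] at this
    have := Nat.le_of_dvd (by norm_num) this
    omega
  have hcard : Fintype.card V = Fintype.card (ZMod v) := by rw [hB.1, ZMod.card]
  have hex := @exists_isPuncturedWalk V (ZMod v) _ _ _ _ hcard B₀ B₁ B₂ l hl hB₁ hB₂ hlen h3 hcount
  obtain ⟨F₀, E₀, l₀, hl₀⟩ := @hex 5 4 3 (fun h => h1 (by linear_combination h))
    (fun h => h2 (by linear_combination h)) (fun h => h1 (by linear_combination h))
  obtain ⟨F₁, E₁, l₁, hl₁⟩ := @hex (-1) (-2) 0 (fun h => h1 (by linear_combination h))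
    (fun h => h1 (by linear_combination -h)) (fun h => h2 (by linear_combination -h))
  obtain ⟨F₂, E₂, l₂, hl₂⟩ := @hex (-3) (-4) (-2) (fun h => h1 (by linear_combination h))
    (fun h => h1 (by linear_combination -h)) (fun h => h2 (by linear_combination -h))
  have hwalk := isWalkList_append_freeRows hw' le_rfl
    ((isWalkList_gadgetZero w l₀ hw' h2 hl₀).append
    (beta_meets_alpha_sub_one (3 : ZMod v) 0 (z := 2) (by norm_num))
    ((isWalkList_gadgetTwo w l₂ hw' h2 hl₂).append
    (corner12_meets_beta (0 : ZMod v) (z := 1) (by norm_num)).symm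
    (isWalkList_gadgetOne w l₁ hw' h2 hl₁)))
  -- The last row is `-1 - w = 6`, so its final triple meets `alpha 5 0` and the cycle closes.
  refine exists_isTTS_isHamiltonian_of_list ?_ hwalk
    (beta_meets_alpha_sub_one _ _ (by linear_combination hw')) ?_ ?_ ?_
  · simp [ZMod.card]
  · simp [gadgetZero]
    omega
  · simp only [List.forall_mem_append]
    exact ⟨⟨card_of_mem_gadgetZero w l₀ h2 hl₀, card_of_mem_gadgetTwo w l₂ h2 hl₂,
      card_of_mem_gadgetOne w l₁ h2 hl₁⟩, card_of_mem_freeRows w w⟩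
  · intro p q hpq
    have h := sum_all_covers hpq hodd
    rw [sum_eq_add_sum_range hw] at h
    simp only [pairCount_append]
    rw [pairCount_gadgetZero hpq hw h2 hl₀, pairCount_gadgetTwo hpq hw h2 hl₂,
      pairCount_gadgetOne hpq hw h2 hl₁, pairCount_freeRows hpq hw le_rfl]
    linarith only [h]
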